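/- \textbf{Model.} A cluster has $M\ge 1$ machines. The cumulative service of machine $i$ is a random process $S_i=(S_i(t))_{t\ge 0}$; the processes $S_1,\dots,S_M$ are identically distributed and have stationary increments, and for all $0\le s<t$ one has $0\le S_i(t)-S_i(s)\le \Delta\,(t-s)$ almost surely and $\mathbb E[S_i(t)-S_i(s)]=t-s$. A job that runs $r$ redundant copies on $r$ machines for a duration $t$ and is then checkpointed receives the service $g(r,t)=\mathbb E\big[\max_{1\le i\le r}(S_i(t)-S_i(0))\big]$ (with $g(0,t)=0$). Jobs $1,\dots,N$ arrive at times $0\le a_1\le\dots\le a_N$ and have workloads $p_j>0$. A feasible schedule (for unit-speed machines that support multitasking) chooses for each job $j$ a number $L_j\in\{1,\dots,2N-1\}$, checkpoint times $a_j=t_j^0<t_j^1<\dots<t_j^{L_j}=c_j$, numbers of copies $r_j^k\in\mathbb N$ and resource shares $x_j^k\in(0,1]$ for $1\le k\le L_j$, such that $\sum_{k}x_j^k\,g(r_j^k,t_j^k-t_j^{k-1})=p_j$ for all $j$; $\sum_j\sum_k x_j^kr_j^k\mathbf 1(t\in(t_j^{k-1},t_j^k])\le M$ for all $t\ge 0$;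 and every $t_j^k$ is an arrival time $a_i$ or a completion time $c_i$ of some job $i$. Let $OPT$ be the infimum of the total flowtime $\sum_j(c_j-a_j)$ over all feasible schedules. \textbf{Algorithm Fair+R with speed $\delta$.} At every arrival and every departure of a job all active jobs are checkpointed, and copies and shares are assigned anew, until the next arrival or departure. Let $n=kM+l$, with $0\le l<M$, be the number of active jobs, numbered $1,\dots,n$ in order of arrival. If $n\ge M$, each of the jobs $l+1,\dots,n$ runs one copy with share $1/k$, and the jobs $1,\dots,l$ wait. If $n<M$, job $n$ runs $M-\lfloor M/n\rfloor(n-1)$ copies, the jobs $1,\dots,n-1$ run $\lfloor M/n\rfloor$ copies each, and all shares are $1$. A job with $r$ copies and share $x$ receives the service $\delta\,x\,g(r,d)$ within $d$ units of time after such an event (before the next one), and it departs once its total service equals its workload. Let $FR_\delta$ be the resulting total flowtime. \textbf{Theorem.} Fair+R is $(4+\epsilon)$-speed $O(1/\epsilon)$-competitive with respect to the total job flowtime: for each $\Delta$ there is a constant $C>0$, depending on $\Delta$ only, such that for every $\epsilon>0$ and all $M$, $S$, $N$, $(a_j)$, $(p_j)$ as above, $$FR_{4+\epsilon}\ \le\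 C\Big(1+\frac1\epsilon\Big)\,OPT .$$ (In particular, the ratio is at most $2C/\epsilon$ for $0<\epsilon\le 1$.) -/

import Mathlib

open MeasureTheory ProbabilityTheory
open scoped ENNReal NNReal

namespace Redundancy

/-- The standing assumptions on the service capacity of `M` machines with peak rate `Δ`.
`S i t` is the cumulative service that machine `i` has delivered by time `t ≥ 0`; the service
delivered in `(s, t]` is `S i t - S i s`. -/
structure IsServiceCapacity {Ω : Type*} [MeasurableSpace Ω] (P : Measure Ω) {M : ℕ} (Δ : ℝ)
    (S : Fin M → ℝ≥0 → Ω → ℝ) : Prop where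
  measurable : ∀ i t, Measurable (S i t)
  /-- The machines are identically distributed as random processes. -/
  identDistrib : ∀ i i', IdentDistrib (fun ω t => S i t ω) (fun ω t => S i' t ω) P P
  /-- The law of an increment depends on the length of the time interval only. -/
  stationary : ∀ i s t,
    IdentDistrib (fun ω => S i (s + t) ω - S i s ω) (fun ω => S i t ω - S i 0 ω) P P
  /-- Cumulative service is nondecreasing. -/
  nonneg : ∀ i s t, s < t → ∀ᵐ ω ∂P, 0 ≤ S i t ω - S i s ω
  /-- The peak rate is `Δ`. -/
  peak : ∀ i s t, s < t → ∀ᵐ ω ∂P, S i t ω - S i s ω ≤ ((t : ℝ) - s) * Δ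
  /-- The mean speed is one. -/
  mean : ∀ i s t, s < t → ∫ ω, (S i t ω - S i s ω) ∂P = (t : ℝ) - s

/-- `g(r, t) = E[max_{i = 1, …, r} S_i(0, t]]`, the mean cumulative service delivered to a job that
runs `r` copies on `r` machines for a duration `t` and is then checkpointed.
It is `0` for `r = 0` (the maximum over the empty family is `0`); as only `M` machines
exist, more than `M` copies are worth no more than `M` copies. -/
noncomputable def meanService {Ω : Type*} [MeasurableSpace Ω] (P : Measure Ω) {M : ℕ}
    (S : Fin M → ℝ≥0 → Ω → ℝ) (r : ℕ) (t : ℝ) : ℝ :=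
  ∫ ω, (⨆ i : {i : Fin M // (i : ℕ) < r}, (S i t.toNNReal ω - S i 0 ω)) ∂P

/-! ### Schedules of a multitasking cluster -/

/-- The decisions of a schedule for `N` jobs. Job `j` is checkpointed at the times
`checkpoint j 0, …, checkpoint j (numIntervals j)`. During the time interval
`(checkpoint j k, checkpoint j (k + 1)]`, where `k < numIntervals j`, it runs `copies j k` redundant
copies, each with the fraction `share j k` of the resource of its machine. -/
structure Schedule (N : ℕ) where
  numIntervals : Fin N → ℕ
  checkpoint : Fin N → ℕ → ℝ
  copies : Fin N → ℕ → ℕ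
  share : Fin N → ℕ → ℝ

/-- The completion time of a job is its last checkpoint. -/
def Schedule.completion {N : ℕ} (z : Schedule N) (j : Fin N) : ℝ :=
  z.checkpoint j (z.numIntervals j)

/-- The feasible schedules on `M` unit-speed machines that support multitasking, for jobs with
arrival times `a` and workloads `p`, where `g` is the service under redundancy. -/
structure Schedule.IsFeasible {N : ℕ} (M : ℕ) (g : ℕ → ℝ → ℝ) (a p : Fin N → ℝ)
    (z : Schedule N) : Prop where
  one_le_numIntervals : ∀ j, 1 ≤ z.numIntervals j
  numIntervals_le : ∀ j, z.numIntervals j ≤ 2 * N - 1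
  checkpoint_zero : ∀ j, z.checkpoint j 0 = a j
  checkpoint_lt : ∀ j, ∀ k < z.numIntervals j, z.checkpoint j k < z.checkpoint j (k + 1)
  /-- Jobs are checkpointed only when some job arrives or departs. -/
  checkpoint_mem : ∀ j, ∀ k ≤ z.numIntervals j,
    z.checkpoint j k ∈ Set.range a ∪ Set.range z.completion
  share_pos : ∀ j, ∀ k < z.numIntervals j, 0 < z.share j k
  share_le_one : ∀ j, ∀ k < z.numIntervals j, z.share j k ≤ 1
  /-- At no time are more than `M` machines in use, counted with their shares. -/
  capacity : ∀ t : ℝ, 0 ≤ t → ∑ j, ∑ k ∈ Finset.range (z.numIntervals j),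
    (Set.Ioc (z.checkpoint j k) (z.checkpoint j (k + 1))).indicator
      (fun _ => z.share j k * (z.copies j k : ℝ)) t ≤ M
  /-- Every job has received exactly its workload at its completion time. -/
  completes : ∀ j, ∑ k ∈ Finset.range (z.numIntervals j),
    z.share j k * g (z.copies j k) (z.checkpoint j (k + 1) - z.checkpoint j k) = p j

/-- The optimal total flowtime on `M` unit-speed machines. -/
noncomputable def optCost {N : ℕ} (M : ℕ) (g : ℕ → ℝ → ℝ) (a p : Fin N → ℝ) : ℝ≥0∞ :=
  ⨅ (z : Schedule N) (_ : z.IsFeasible M g a p), ENNReal.ofReal (∑ j, (z.completion j - a j))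

/-! ### The algorithm Fair+R -/

/-- The position `1, …, n` of an active job in the list of the `n` active jobs, sorted by arrival.
The jobs are numbered in the order of their arrival. -/
def position {N : ℕ} (A : Finset (Fin N)) (j : Fin N) : ℕ :=
  (A.filter (fun i => i ≤ j)).card

/-- The number of copies of job `j` under Fair+R when `A` is the set of active jobs. If there are
`n = k * M + l ≥ M` active jobs, the latest `k * M` of them run one copy each and the others wait.
If `n < M`, every job runs `⌊M / n⌋` copies, except that the latest one runs on all remaining
machines. -/
def fairRCopies {N : ℕ} (M : ℕ) (A : Finset (Fin N)) (j : Fin N) : ℕ :=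
  if j ∉ A then 0
  else if M ≤ A.card then (if A.card % M < position A j then 1 else 0)
  else if position A j = A.card then M - (M / A.card) * (A.card - 1)
  else M / A.card

/-- The resource share of job `j` under Fair+R when `A` is the set of active jobs: `1 / k` for the
latest `k * M` jobs if there are `n = k * M + l ≥ M` active jobs, and `1` for all if `n < M`. -/
noncomputable def fairRShare {N : ℕ} (M : ℕ) (A : Finset (Fin N)) (j : Fin N) : ℝ :=
  if j ∉ A then 0
  else if M ≤ A.card then (if A.card % M < position A j then 1 / ((A.card / M : ℕ) : ℝ) else 0)
  else 1

/-- The work done on job `j` by Fair+R with speed `δ` during a period of length `d` at the beginning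
and the end of which all jobs are checkpointed and during which `A` is the set of active jobs. -/
noncomputable def fairRWork {N : ℕ} (M : ℕ) (g : ℕ → ℝ → ℝ) (δ : ℝ) (A : Finset (Fin N))
    (j : Fin N) (d : ℝ) : ℝ :=
  δ * (fairRShare M A j * g (fairRCopies M A j) d)

/-- A snapshot of the cluster: the current time and the unprocessed work of every job. -/
structure State (N : ℕ) where
  time : ℝ
  work : Fin N → ℝ

/-- The active jobs: those that have arrived and are not complete. -/
noncomputable def State.active {N : ℕ} (a : Fin N → ℝ) (s : State N) : Finset (Fin N) :=
  open Classical in Finset.univ.filter (fun j => a j ≤ s.time ∧ 0 < s.work j)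

/-- The time that passes under Fair+R with speed `δ` from the snapshot `s` until the next event, that
is, the next arrival of a job or the next departure (the first moment at which the work done on some
active job since `s` reaches the work that was unprocessed). It is `0` if there is no further event
(the infimum of the empty set is `0`). -/
noncomputable def State.delay {N : ℕ} (M : ℕ) (g : ℕ → ℝ → ℝ) (δ : ℝ) (a : Fin N → ℝ)
    (s : State N) : ℝ :=
  sInf {d : ℝ | 0 < d ∧ ((∃ j, s.time + d = a j) ∨
    ∃ j ∈ s.active a, s.work j ≤ fairRWork M g δ (s.active a) j d)}

/-- Fair+R with speed `δ` runs from the snapshot `s` to the next event, where all jobs are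
checkpointed. -/
noncomputable def State.next {N : ℕ} (M : ℕ) (g : ℕ → ℝ → ℝ) (δ : ℝ) (a : Fin N → ℝ)
    (s : State N) : State N where
  time := s.time + s.delay M g δ a
  work := fun j => s.work j - fairRWork M g δ (s.active a) j (s.delay M g δ a)

/-- The snapshot at the `m`-th event of the run of Fair+R with speed `δ`; the run starts at time `0`. -/
noncomputable def fairRState {N : ℕ} (M : ℕ) (g : ℕ → ℝ → ℝ) (δ : ℝ) (a p : Fin N → ℝ) :
    ℕ → State N
  | 0 => ⟨0, p⟩
  | m + 1 => (fairRState M g δ a p m).next M g δ a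

/-- The flowtime of job `j` under Fair+R with speed `δ`: the time from its arrival to the first event
at which no work is left. It is `∞` if the job never completes. -/
noncomputable def fairRFlowtime {N : ℕ} (M : ℕ) (g : ℕ → ℝ → ℝ) (δ : ℝ) (a p : Fin N → ℝ)
    (j : Fin N) : ℝ≥0∞ :=
  ⨅ (m : ℕ) (_ : (fairRState M g δ a p m).work j ≤ 0),
    ENNReal.ofReal ((fairRState M g δ a p m).time - a j)

/-- The total flowtime under Fair+R with speed `δ`. -/
noncomputable def fairRCost {N : ℕ} (M : ℕ) (g : ℕ → ℝ → ℝ) (δ : ℝ) (a p : Fin N → ℝ) : ℝ≥0∞ :=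
  ∑ j, fairRFlowtime M g δ a p j

end Redundancy

namespace Redundancy

/-! Amortized analysis against a fixed feasible schedule `z`, with potential Φ = Σ w(i)·lag over the
active jobs. The lag of a job is how far Fair+R is behind `z` on it (at least 0), i is its position
in arrival order, and w(i) = max(1, i/M). Since g is nonlinear in time, the comparison is made over
whole periods between consecutive events of Fair+R. Only a few bounds on g enter: continuity, g(r,t)
≥ t for r ≥ 1, and g(r,t) ≤ min(Δ, r)·t.

Events never raise Φ: a new job has lag 0, a departing job only removes a nonnegative term, and
later arrivals do not change the positions of earlier ones. Consider a period of length d with n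
active jobs, and let T be the total time that these jobs are alive in `z` during it. If n < M, all
weights are 1, Fair+R does at least δd on each job, and `z` raises lags by at most ΔT; hence ΔΦ ≤
(Δ+δ)T − δnd. If n = kM + l ≥ M, then `z` does work at most Md and weights are at most n/M, so it
raises Φ by at most nd. Fair+R serves the last kM jobs, whose average position is at least n/2, at
rate at least δ/k, which lowers Φ by δnd/2, up to 2δT for jobs still alive in `z`.

With δ = 4+ε and c = 1/(1+ε/2), both cases give nd + cΔΦ ≤ (Δ+8)T
(`card_mul_delay_add_potential_le`). Summing over periods, nd adds up to the flowtime of Fair+R and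
T to at most that of `z`. The resulting ratio Δ+8 does not even depend on ε. -/

/-- The properties of the service function `g` on which the analysis of Fair+R rests. -/
structure IsServiceFunction (Δ : ℝ) (g : ℕ → ℝ → ℝ) : Prop where
  continuous : ∀ r, Continuous (g r)
  nonneg : ∀ r t, 0 ≤ t → 0 ≤ g r t
  le_of_one_le : ∀ r t, 1 ≤ r → 0 ≤ t → t ≤ g r t
  le_peak : ∀ r t, 0 ≤ t → g r t ≤ Δ * t
  le_copies : ∀ r t, 0 ≤ t → g r t ≤ r * t

theorem IsServiceFunction.one_le_peak {Δ : ℝ} {g : ℕ → ℝ → ℝ} (hg : IsServiceFunction Δ g) :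
    1 ≤ Δ := by
  have h1 := hg.le_of_one_le 1 1 le_rfl zero_le_one
  have h2 := hg.le_peak 1 1 zero_le_one
  linarith

theorem IsServiceFunction.apply_zero {Δ : ℝ} {g : ℕ → ℝ → ℝ} (hg : IsServiceFunction Δ g) (r : ℕ) :
    g r 0 = 0 :=
  le_antisymm (by simpa using hg.le_peak r 0 le_rfl) (hg.nonneg r 0 le_rfl)

theorem iSup_le_iSup_and_le_add {ι : Type*} [Finite ι] {u v : ι → ℝ} {c : ℝ} (hc : 0 ≤ c)
    (huv : ∀ i, u i ≤ v i) (hvu : ∀ i, v i ≤ u i + c) :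
    ⨆ i, u i ≤ ⨆ i, v i ∧ ⨆ i, v i ≤ (⨆ i, u i) + c := by
  rcases isEmpty_or_nonempty ι with h | h
  · simp [Real.iSup_of_isEmpty, hc]
  · exact ⟨ciSup_mono (Set.finite_range v).bddAbove huv,
      ciSup_le fun i => (hvu i).trans
        (add_le_add_left (le_ciSup (Set.finite_range u).bddAbove i) c)⟩

/-! ### Bounds on the mean service under redundancy. -/

section Service

variable {Ω : Type*} [MeasurableSpace Ω] {P : Measure Ω} {M : ℕ} {Δ : ℝ}
  {S : Fin M → ℝ≥0 → Ω → ℝ}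

theorem IsServiceCapacity.integral_sub (hS : IsServiceCapacity P Δ S) (i : Fin M) {s t : ℝ≥0}
    (hst : s ≤ t) : ∫ ω, (S i t ω - S i s ω) ∂P = (t : ℝ) - s := by
  rcases hst.eq_or_lt with rfl | h
  · simp
  · exact hS.mean i s t h

theorem IsServiceCapacity.ae_sub_mem (hS : IsServiceCapacity P Δ S) {s t : ℝ≥0} (hst : s ≤ t) :
    ∀ᵐ ω ∂P, ∀ i, 0 ≤ S i t ω - S i s ω ∧ S i t ω - S i s ω ≤ ((t : ℝ) - s) * Δ := by
  rcases hst.eq_or_lt with rfl | h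
  · simp
  · rw [ae_all_iff]
    intro i
    filter_upwards [hS.nonneg i s t h, hS.peak i s t h] with ω h1 h2
    exact ⟨h1, h2⟩

theorem meanService_zero (r : ℕ) : meanService P S r 0 = 0 := by
  simp [meanService]

variable [IsProbabilityMeasure P]

theorem IsServiceCapacity.integrable_sub (hS : IsServiceCapacity P Δ S) (i : Fin M) {s t : ℝ≥0}
    (hst : s ≤ t) : Integrable (fun ω => S i t ω - S i s ω) P := by
  rcases hst.eq_or_lt with rfl | h
  · simp
  · refine Integrable.of_bound (C := ((t : ℝ) - s) * Δ)
      ((hS.measurable i t).sub (hS.measurable i s)).aestronglyMeasurable ?_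
    filter_upwards [hS.nonneg i s t h, hS.peak i s t h] with ω h1 h2
    rwa [Real.norm_eq_abs, abs_of_nonneg h1]

theorem IsServiceCapacity.peak_nonneg (hS : IsServiceCapacity P Δ S) (hM : 0 < M) : 0 ≤ Δ := by
  obtain ⟨ω, h⟩ := (hS.ae_sub_mem (zero_le_one : (0 : ℝ≥0) ≤ 1)).exists
  have := (h ⟨0, hM⟩).1.trans (h ⟨0, hM⟩).2
  simpa using this

theorem IsServiceCapacity.integrable_iSup (hS : IsServiceCapacity P Δ S) (hM : 0 < M) (r : ℕ)
    (t : ℝ≥0) :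
    Integrable (fun ω => ⨆ i : {i : Fin M // (i : ℕ) < r}, (S i t ω - S i 0 ω)) P := by
  refine Integrable.of_bound (C := ((t : ℝ) - (0 : ℝ≥0)) * Δ)
    (Measurable.iSup fun i : {i : Fin M // (i : ℕ) < r} =>
      (hS.measurable i t).sub (hS.measurable i 0)).aestronglyMeasurable ?_
  filter_upwards [hS.ae_sub_mem (zero_le : 0 ≤ t)] with ω h
  rw [Real.norm_eq_abs, abs_of_nonneg (Real.iSup_nonneg fun i : {i : Fin M // (i : ℕ) < r} => (h i).1)]
  exact Real.iSup_le (fun i => (h i).2) (mul_nonneg (by simp) (hS.peak_nonneg hM))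

/-- Almost surely, between times s and t every machine gains between 0 and Δ(t − s), so the maximum
over machines does too; then take expectations. For negative arguments `toNNReal` truncates, which
only shortens the increment. -/
theorem IsServiceCapacity.meanService_mono_and_le_add (hS : IsServiceCapacity P Δ S) (hM : 0 < M)
    (r : ℕ) {s t : ℝ} (hst : s ≤ t) :
    meanService P S r s ≤ meanService P S r t ∧
      meanService P S r t ≤ meanService P S r s + Δ * (t - s) := by
  have hn : s.toNNReal ≤ t.toNNReal := Real.toNNReal_le_toNNReal hst
  have hd : (t.toNNReal : ℝ) - s.toNNReal ≤ t - s := by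
    simp only [Real.coe_toNNReal']
    rcases max_cases s 0 with ⟨h1, _⟩ | ⟨h1, _⟩ <;> rcases max_cases t 0 with ⟨h2, _⟩ | ⟨h2, _⟩ <;>
      rw [h1, h2] <;> linarith
  have hc : 0 ≤ ((t.toNNReal : ℝ) - s.toNNReal) * Δ :=
    mul_nonneg (sub_nonneg.2 (NNReal.coe_le_coe.2 hn)) (hS.peak_nonneg hM)
  have key : ∀ᵐ ω ∂P, ⨆ i : {i : Fin M // (i : ℕ) < r}, (S i s.toNNReal ω - S i 0 ω) ≤
        ⨆ i : {i : Fin M // (i : ℕ) < r}, (S i t.toNNReal ω - S i 0 ω) ∧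
      ⨆ i : {i : Fin M // (i : ℕ) < r}, (S i t.toNNReal ω - S i 0 ω) ≤
        (⨆ i : {i : Fin M // (i : ℕ) < r}, (S i s.toNNReal ω - S i 0 ω)) +
          ((t.toNNReal : ℝ) - s.toNNReal) * Δ := by
    filter_upwards [hS.ae_sub_mem hn] with ω h
    exact iSup_le_iSup_and_le_add hc (fun i => by linarith [(h i).1])
      (fun i => by linarith [(h i).2])
  have hs := hS.integrable_iSup hM r s.toNNReal
  have ht := hS.integrable_iSup hM r t.toNNReal
  refine ⟨integral_mono_ae hs ht (key.mono fun ω h => h.1), ?_⟩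
  have h := integral_mono_ae ht (hs.add (integrable_const (((t.toNNReal : ℝ) - s.toNNReal) * Δ)))
    (key.mono fun ω h => h.2)
  rw [integral_add' hs (integrable_const _), integral_const, probReal_univ, one_smul] at h
  have := mul_le_mul_of_nonneg_right hd (hS.peak_nonneg hM)
  unfold meanService
  linarith

/-- A maximum of nonnegative services is at least the service of one machine, of mean t, and at most
the sum over the at most r machines used, of mean at most r·t. -/
theorem IsServiceCapacity.isServiceFunction (hS : IsServiceCapacity P Δ S) (hM : 0 < M) :
    IsServiceFunction Δ (meanService P S) where
  continuous r := by
    refine (LipschitzWith.of_le_add_mul Δ.toNNReal fun x y => ?_).continuous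
    rw [Real.coe_toNNReal _ (hS.peak_nonneg hM), Real.dist_eq]
    rcases le_total x y with h | h
    · have := (hS.meanService_mono_and_le_add hM r h).1
      have := mul_nonneg (hS.peak_nonneg hM) (abs_nonneg (x - y))
      linarith
    · rw [abs_of_nonneg (sub_nonneg.2 h)]
      exact (hS.meanService_mono_and_le_add hM r h).2
  nonneg r t ht := by
    simpa [meanService_zero] using (hS.meanService_mono_and_le_add hM r ht).1
  le_of_one_le r t hr ht := by
    have h := hS.integral_sub ⟨0, hM⟩ (zero_le : 0 ≤ t.toNNReal)
    rw [Real.coe_toNNReal _ ht, NNReal.coe_zero, sub_zero] at h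
    conv_lhs => rw [← h]
    refine integral_mono (hS.integrable_sub _ zero_le) (hS.integrable_iSup hM r _) fun ω => ?_
    exact le_ciSup (f := fun i : {i : Fin M // (i : ℕ) < r} => S i t.toNNReal ω - S i 0 ω)
      (Set.finite_range _).bddAbove ⟨⟨0, hM⟩, hr⟩
  le_peak r t ht := by
    simpa [meanService_zero] using (hS.meanService_mono_and_le_add hM r ht).2
  le_copies r t ht := by
    have h : meanService P S r t ≤
        ∫ ω, ∑ i : {i : Fin M // (i : ℕ) < r}, (S i t.toNNReal ω - S i 0 ω) ∂P := by
      refine integral_mono_ae (hS.integrable_iSup hM r _)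
        (integrable_finsetSum _ fun i _ => hS.integrable_sub _ zero_le) ?_
      filter_upwards [hS.ae_sub_mem (zero_le : 0 ≤ t.toNNReal)] with ω h
      exact Real.iSup_le (fun i => Finset.single_le_sum
        (f := fun i : {i : Fin M // (i : ℕ) < r} => S i t.toNNReal ω - S i 0 ω)
        (fun i _ => (h i).1) (Finset.mem_univ i)) (Finset.sum_nonneg fun i _ => (h i).1)
    rw [integral_finsetSum _ fun i _ => hS.integrable_sub _ zero_le] at h
    simp only [hS.integral_sub _ (zero_le : 0 ≤ t.toNNReal), Real.coe_toNNReal _ ht,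
      NNReal.coe_zero, sub_zero, Finset.sum_const, nsmul_eq_mul, Finset.card_univ] at h
    refine h.trans (mul_le_mul_of_nonneg_right (Nat.cast_le.2 ?_) ht)
    have hinj : Function.Injective
        (fun i : {i : Fin M // (i : ℕ) < r} => (⟨i.1, i.2⟩ : Fin r)) := by
      intro i j hij
      exact Subtype.ext (Fin.ext (by simpa using hij))
    simpa using Fintype.card_le_of_injective _ hinj

end Service

/-! ### The work done by a feasible schedule -/

/-- The length of the part of `(s, e]` that lies before time `t`. -/
noncomputable def elapsed (s e t : ℝ) : ℝ := min t e - min t s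

theorem elapsed_mono {s e : ℝ} (h : s ≤ e) : Monotone (elapsed s e) := by
  intro t t' ht
  unfold elapsed
  grind

theorem elapsed_of_le {s e t : ℝ} (h : s ≤ e) (ht : t ≤ s) : elapsed s e t = 0 := by
  unfold elapsed
  grind

theorem elapsed_of_ge {s e t : ℝ} (h : s ≤ e) (ht : e ≤ t) : elapsed s e t = e - s := by
  unfold elapsed
  grind

theorem elapsed_le {s e t : ℝ} (h : s ≤ e) : elapsed s e t ≤ e - s := by
  unfold elapsed
  grind

theorem elapsed_sub_of_mem {s e t t' : ℝ} (hs : s ≤ t) (ht : t ≤ t') (he : t' ≤ e) :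
    elapsed s e t' - elapsed s e t = t' - t := by
  unfold elapsed
  grind

theorem elapsed_sub_eq_integral {s e t t' : ℝ} (h : s ≤ e) (ht : t ≤ t') :
    elapsed s e t' - elapsed s e t =
      ∫ u in Set.Ioc t t', (Set.Ioc s e).indicator (fun _ => (1 : ℝ)) u := by
  rw [integral_indicator measurableSet_Ioc, Measure.restrict_restrict measurableSet_Ioc,
    Set.Ioc_inter_Ioc, setIntegral_const, smul_eq_mul, mul_one, Real.volume_real_Ioc]
  unfold elapsed
  grind

namespace Schedule

variable {N : ℕ}

/-- The work done on job `j` by time `t`, if the service in every checkpointing interval is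
delivered at a constant rate. -/
noncomputable def workDone (z : Schedule N) (g : ℕ → ℝ → ℝ) (j : Fin N) (t : ℝ) : ℝ :=
  ∑ k ∈ Finset.range (z.numIntervals j),
    z.share j k * g (z.copies j k) (z.checkpoint j (k + 1) - z.checkpoint j k) /
      (z.checkpoint j (k + 1) - z.checkpoint j k) *
      elapsed (z.checkpoint j k) (z.checkpoint j (k + 1)) t

variable {M : ℕ} {Δ : ℝ} {g : ℕ → ℝ → ℝ} {a p : Fin N → ℝ} {z : Schedule N}

theorem IsFeasible.checkpoint_le_checkpoint (hz : z.IsFeasible M g a p) (j : Fin N) {k l : ℕ}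
    (hkl : k ≤ l) (hl : l ≤ z.numIntervals j) : z.checkpoint j k ≤ z.checkpoint j l := by
  induction l, hkl using Nat.le_induction with
  | base => rfl
  | succ l _ ih => exact (ih (by omega)).trans (hz.checkpoint_lt j l (by omega)).le

theorem IsFeasible.arrival_le_completion (hz : z.IsFeasible M g a p) (j : Fin N) :
    a j ≤ z.completion j := by
  rw [← hz.checkpoint_zero j]
  exact hz.checkpoint_le_checkpoint j (Nat.zero_le _) le_rfl

theorem IsFeasible.rate_nonneg (hz : z.IsFeasible M g a p) (hg : IsServiceFunction Δ g)
    {j : Fin N} {k : ℕ} (hk : k < z.numIntervals j) :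
    0 ≤ z.share j k * g (z.copies j k) (z.checkpoint j (k + 1) - z.checkpoint j k) /
      (z.checkpoint j (k + 1) - z.checkpoint j k) := by
  have hd := sub_pos.2 (hz.checkpoint_lt j k hk)
  exact div_nonneg (mul_nonneg (hz.share_pos j k hk).le (hg.nonneg _ _ hd.le)) hd.le

theorem IsFeasible.rate_le_peak (hz : z.IsFeasible M g a p) (hg : IsServiceFunction Δ g)
    {j : Fin N} {k : ℕ} (hk : k < z.numIntervals j) :
    z.share j k * g (z.copies j k) (z.checkpoint j (k + 1) - z.checkpoint j k) /
      (z.checkpoint j (k + 1) - z.checkpoint j k) ≤ Δ := by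
  have hd := sub_pos.2 (hz.checkpoint_lt j k hk)
  rw [div_le_iff₀ hd]
  have h0 := hg.nonneg (z.copies j k) _ hd.le
  have h1 := hg.le_peak (z.copies j k) _ hd.le
  have h2 := mul_le_mul_of_nonneg_right (hz.share_le_one j k hk) h0
  linarith

theorem IsFeasible.rate_le_copies (hz : z.IsFeasible M g a p) (hg : IsServiceFunction Δ g)
    {j : Fin N} {k : ℕ} (hk : k < z.numIntervals j) :
    z.share j k * g (z.copies j k) (z.checkpoint j (k + 1) - z.checkpoint j k) /
      (z.checkpoint j (k + 1) - z.checkpoint j k) ≤ z.share j k * z.copies j k := by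
  have hd := sub_pos.2 (hz.checkpoint_lt j k hk)
  rw [div_le_iff₀ hd, mul_assoc]
  exact mul_le_mul_of_nonneg_left (hg.le_copies _ _ hd.le) (hz.share_pos j k hk).le

theorem IsFeasible.workDone_mono (hz : z.IsFeasible M g a p) (hg : IsServiceFunction Δ g)
    (j : Fin N) : Monotone (z.workDone g j) := by
  intro t t' ht
  refine Finset.sum_le_sum fun k hk => ?_
  have hk := Finset.mem_range.1 hk
  exact mul_le_mul_of_nonneg_left (elapsed_mono (hz.checkpoint_lt j k hk).le ht)
    (hz.rate_nonneg hg hk)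

theorem IsFeasible.workDone_of_le (hz : z.IsFeasible M g a p) (j : Fin N) {t : ℝ} (ht : t ≤ a j) :
    z.workDone g j t = 0 := by
  refine Finset.sum_eq_zero fun k hk => ?_
  have hk := Finset.mem_range.1 hk
  rw [elapsed_of_le (hz.checkpoint_lt j k hk).le, mul_zero]
  rw [← hz.checkpoint_zero j] at ht
  exact ht.trans (hz.checkpoint_le_checkpoint j (Nat.zero_le _) hk.le)

theorem IsFeasible.workDone_of_ge (hz : z.IsFeasible M g a p) (j : Fin N) {t : ℝ}
    (ht : z.completion j ≤ t) : z.workDone g j t = p j := by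
  rw [← hz.completes j]
  refine Finset.sum_congr rfl fun k hk => ?_
  have hk := Finset.mem_range.1 hk
  have hd := sub_pos.2 (hz.checkpoint_lt j k hk)
  rw [elapsed_of_ge (hz.checkpoint_lt j k hk).le
    ((hz.checkpoint_le_checkpoint j hk le_rfl).trans ht), div_mul_cancel₀ _ hd.ne']

theorem IsFeasible.workDone_sub_le_peak (hz : z.IsFeasible M g a p) (hg : IsServiceFunction Δ g)
    (j : Fin N) {t t' : ℝ} (ht : t ≤ t') :
    z.workDone g j t' - z.workDone g j t ≤
      Δ * (elapsed (a j) (z.completion j) t' - elapsed (a j) (z.completion j) t) := by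
  -- The checkpointing intervals of a job partition its lifetime in `z`.
  have htel : ∀ u, elapsed (a j) (z.completion j) u = ∑ k ∈ Finset.range (z.numIntervals j),
      elapsed (z.checkpoint j k) (z.checkpoint j (k + 1)) u := fun u => by
    unfold elapsed
    rw [Finset.sum_range_sub (fun k => min u (z.checkpoint j k)), hz.checkpoint_zero, completion]
  unfold workDone
  rw [htel, htel, ← Finset.sum_sub_distrib, ← Finset.sum_sub_distrib, Finset.mul_sum]
  refine Finset.sum_le_sum fun k hk => ?_
  have hk := Finset.mem_range.1 hk
  rw [← mul_sub]
  exact mul_le_mul_of_nonneg_right (hz.rate_le_peak hg hk)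
    (sub_nonneg.2 (elapsed_mono (hz.checkpoint_lt j k hk).le ht))

/-- Redundancy never beats using the copies in parallel: g(r,t) ≤ r·t bounds the work rate by the
machine usage, which the capacity constraint bounds by M at every time. -/
theorem IsFeasible.sum_workDone_sub_le (hz : z.IsFeasible M g a p) (hg : IsServiceFunction Δ g)
    {t t' : ℝ} (h0 : 0 ≤ t) (ht : t ≤ t') :
    ∑ j, (z.workDone g j t' - z.workDone g j t) ≤ M * (t' - t) := by
  have hint : ∀ j k, Integrable (fun u =>
      (Set.Ioc (z.checkpoint j k) (z.checkpoint j (k + 1))).indicator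
        (fun _ => z.share j k * (z.copies j k : ℝ)) u) (volume.restrict (Set.Ioc t t')) :=
    fun j k => (integrable_const _).indicator measurableSet_Ioc
  calc ∑ j, (z.workDone g j t' - z.workDone g j t)
      ≤ ∑ j, ∑ k ∈ Finset.range (z.numIntervals j), ∫ u in Set.Ioc t t',
          (Set.Ioc (z.checkpoint j k) (z.checkpoint j (k + 1))).indicator
            (fun _ => z.share j k * (z.copies j k : ℝ)) u := by
        refine Finset.sum_le_sum fun j _ => ?_
        unfold workDone
        rw [← Finset.sum_sub_distrib]
        refine Finset.sum_le_sum fun k hk => ?_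
        have hk := Finset.mem_range.1 hk
        have hle := (hz.checkpoint_lt j k hk).le
        rw [← mul_sub]
        refine (mul_le_mul_of_nonneg_right (hz.rate_le_copies hg hk)
          (sub_nonneg.2 (elapsed_mono hle ht))).trans_eq ?_
        rw [elapsed_sub_eq_integral hle ht, ← integral_const_mul]
        congr 1 with u
        by_cases hu : u ∈ Set.Ioc (z.checkpoint j k) (z.checkpoint j (k + 1)) <;> simp [hu]
    _ = ∫ u in Set.Ioc t t', ∑ j, ∑ k ∈ Finset.range (z.numIntervals j),
          (Set.Ioc (z.checkpoint j k) (z.checkpoint j (k + 1))).indicator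
            (fun _ => z.share j k * (z.copies j k : ℝ)) u := by
        rw [integral_finsetSum _ fun j _ => integrable_finsetSum _ fun k _ => hint j k]
        refine Finset.sum_congr rfl fun j _ => ?_
        rw [integral_finsetSum _ fun k _ => hint j k]
    _ ≤ ∫ _ in Set.Ioc t t', (M : ℝ) := by
        refine setIntegral_mono_on (integrable_finsetSum _ fun j _ =>
          integrable_finsetSum _ fun k _ => hint j k) (integrable_const _) measurableSet_Ioc
          fun u hu => hz.capacity u (h0.trans hu.1.le)
    _ = M * (t' - t) := by
        rw [setIntegral_const, Real.volume_real_Ioc_of_le ht, smul_eq_mul, mul_comm]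

end Schedule

/-! ### Positions of the active jobs -/

section Position

variable {N : ℕ} {A : Finset (Fin N)} {j : Fin N}

theorem position_le_card (A : Finset (Fin N)) (j : Fin N) : position A j ≤ A.card :=
  Finset.card_filter_le _ _

theorem position_max' (h : A.Nonempty) : position A (A.max' h) = A.card := by
  unfold position
  rw [Finset.filter_true_of_mem fun i hi => A.le_max' i hi]

/-- The positions enumerate 1, …, |A|; removing the latest job leaves the other positions unchanged.
-/
theorem sum_position {R : Type*} [AddCommMonoid R] (A : Finset (Fin N)) (φ : ℕ → R) :
    ∑ j ∈ A, φ (position A j) = ∑ i ∈ Finset.range A.card, φ (i + 1) := by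
  induction A using Finset.induction_on_max with
  | empty => simp
  | insert b A hb ih =>
    have hbA : b ∉ A := fun h => lt_irrefl _ (hb b h)
    rw [Finset.sum_insert hbA, Finset.card_insert_of_notMem hbA, Finset.sum_range_succ, ← ih,
      add_comm]
    congr 1
    · refine Finset.sum_congr rfl fun j hj => ?_
      unfold position
      rw [Finset.filter_insert, if_neg (not_le.2 (hb j hj))]
    · unfold position
      rw [Finset.filter_true_of_mem, Finset.card_insert_of_notMem hbA]
      intro i hi
      rcases Finset.mem_insert.1 hi with rfl | h
      exacts [le_rfl, (hb i h).le]

theorem two_mul_sum_range_ite_lt (l q : ℕ) :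
    2 * ∑ i ∈ Finset.range (l + q), (if l < i + 1 then i + 1 else 0) = q * (2 * l + q + 1) := by
  induction q with
  | zero =>
    rw [Finset.sum_eq_zero fun i hi => if_neg (by simpa using hi)]
    simp
  | succ q ih =>
    rw [← add_assoc, Finset.sum_range_succ, mul_add, ih, if_pos (by omega)]
    ring

/-- The jobs that do not wait occupy the last kM positions, whose average (2l + kM + 1)/2 exceeds
n/2. -/
theorem card_mul_le_two_mul_sum_position (A : Finset (Fin N)) (M : ℕ) :
    A.card / M * M * A.card ≤
      2 * ∑ j ∈ A, (if A.card % M < position A j then position A j else 0) := by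
  rw [sum_position A fun i => if A.card % M < i then i else 0]
  have h : A.card = A.card % M + A.card / M * M := by rw [add_comm, Nat.div_add_mod']
  have := two_mul_sum_range_ite_lt (A.card % M) (A.card / M * M)
  rw [← h] at this
  rw [this]
  refine Nat.mul_le_mul_left _ ?_
  omega

end Position

/-! ### The work done by Fair+R -/

section Work

variable {N M : ℕ} {Δ δ : ℝ} {g : ℕ → ℝ → ℝ} {A : Finset (Fin N)} {j : Fin N}

theorem fairRShare_nonneg (M : ℕ) (A : Finset (Fin N)) (j : Fin N) : 0 ≤ fairRShare M A j := by
  unfold fairRShare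
  split_ifs <;> positivity

theorem fairRWork_of_notMem (d : ℝ) (hj : j ∉ A) : fairRWork M g δ A j d = 0 := by
  simp [fairRWork, fairRShare, hj]

theorem fairRWork_zero (hg : IsServiceFunction Δ g) : fairRWork M g δ A j 0 = 0 := by
  simp [fairRWork, hg.apply_zero]

theorem fairRWork_nonneg (hg : IsServiceFunction Δ g) (hδ : 0 < δ) {d : ℝ} (hd : 0 ≤ d) :
    0 ≤ fairRWork M g δ A j d :=
  mul_nonneg hδ.le (mul_nonneg (fairRShare_nonneg M A j) (hg.nonneg _ _ hd))

theorem continuous_fairRWork (hg : IsServiceFunction Δ g) : Continuous (fairRWork M g δ A j) :=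
  continuous_const.mul (continuous_const.mul (hg.continuous _))

theorem le_fairRWork_of_card_lt (hg : IsServiceFunction Δ g) (hδ : 0 < δ) {d : ℝ} (hd : 0 ≤ d)
    (hA : A.card < M) (hj : j ∈ A) : δ * d ≤ fairRWork M g δ A j d := by
  have hn : 0 < A.card := Finset.card_pos.2 ⟨j, hj⟩
  have hq : 1 ≤ M / A.card := (Nat.one_le_div_iff hn).2 hA.le
  have hc : 1 ≤ fairRCopies M A j := by
    unfold fairRCopies
    rw [if_neg (not_not.2 hj), if_neg (not_le.2 hA)]
    split_ifs
    · have h1 := Nat.div_mul_le_self M A.card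
      rw [Nat.mul_sub, mul_one]
      have : M / A.card ≤ M / A.card * A.card := Nat.le_mul_of_pos_right _ hn
      omega
    · exact hq
  have hs : fairRShare M A j = 1 := by
    unfold fairRShare
    rw [if_neg (not_not.2 hj), if_neg (not_le.2 hA)]
  rw [fairRWork, hs, one_mul]
  exact mul_le_mul_of_nonneg_left (hg.le_of_one_le _ _ hc hd) hδ.le

theorem le_fairRWork_of_le_card (hg : IsServiceFunction Δ g) (hδ : 0 < δ) {d : ℝ} (hd : 0 ≤ d)
    (hA : M ≤ A.card) (hj : j ∈ A) (hl : A.card % M < position A j) :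
    δ / (A.card / M : ℕ) * d ≤ fairRWork M g δ A j d := by
  have hc : fairRCopies M A j = 1 := by
    unfold fairRCopies
    rw [if_neg (not_not.2 hj), if_pos hA, if_pos hl]
  have hs : fairRShare M A j = 1 / (A.card / M : ℕ) := by
    unfold fairRShare
    rw [if_neg (not_not.2 hj), if_pos hA, if_pos hl]
  rw [fairRWork, hs, hc, div_eq_mul_one_div, mul_assoc]
  exact mul_le_mul_of_nonneg_left (mul_le_mul_of_nonneg_left (hg.le_of_one_le _ _ le_rfl hd)
    (by positivity)) hδ.le

/-- Fair+R eventually completes the latest active job if nothing else happens. -/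
theorem exists_le_fairRWork (hg : IsServiceFunction Δ g) (hδ : 0 < δ) (hM : 0 < M)
    (hA : A.Nonempty) (w : ℝ) : ∃ j ∈ A, ∃ d, 0 < d ∧ w ≤ fairRWork M g δ A j d := by
  refine ⟨A.max' hA, A.max'_mem hA, ?_⟩
  have hd : 0 < |w| + 1 := by positivity
  have key : ∀ c : ℝ, 0 < c → (∀ d, 0 ≤ d → c * d ≤ fairRWork M g δ A (A.max' hA) d) →
      ∃ d, 0 < d ∧ w ≤ fairRWork M g δ A (A.max' hA) d := by
    intro c hc h
    refine ⟨(|w| + 1) / c, by positivity, le_trans ?_ (h _ (by positivity))⟩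
    rw [mul_div_cancel₀ _ hc.ne']
    linarith [le_abs_self w]
  rcases lt_or_ge A.card M with h | h
  · exact key δ hδ fun d hd => le_fairRWork_of_card_lt hg hδ hd h (A.max'_mem hA)
  · have hk : 0 < A.card / M := Nat.div_pos h hM
    refine key (δ / (A.card / M : ℕ)) (by positivity) fun d hd =>
      le_fairRWork_of_le_card hg hδ hd h (A.max'_mem hA) ?_
    -- The latest job never waits: its position is n ≥ M > l.
    rw [position_max']
    exact (Nat.mod_lt _ hM).trans_le h

end Work

/-! ### The next event -/

section Delay

variable {N M : ℕ} {Δ δ : ℝ} {g : ℕ → ℝ → ℝ} {a : Fin N → ℝ} {s : State N}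

theorem State.mem_active {j : Fin N} : j ∈ s.active a ↔ a j ≤ s.time ∧ 0 < s.work j := by
  simp [State.active]

theorem State.delay_nonneg : 0 ≤ s.delay M g δ a :=
  Real.sInf_nonneg fun _ hd => hd.1.le

theorem State.delay_le {d : ℝ} (hd : 0 < d) (h : (∃ j, s.time + d = a j) ∨
    ∃ j ∈ s.active a, s.work j ≤ fairRWork M g δ (s.active a) j d) : s.delay M g δ a ≤ d :=
  csInf_le ⟨0, fun _ hd => hd.1.le⟩ ⟨hd, h⟩

theorem State.time_add_delay_le {j : Fin N} (hj : s.time < a j) :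
    s.time + s.delay M g δ a ≤ a j := by
  have := State.delay_le (M := M) (g := g) (δ := δ) (sub_pos.2 hj) (Or.inl ⟨j, by ring⟩)
  linarith

/-- No job overshoots its workload: otherwise, by continuity, it would have departed strictly before
the next event. -/
theorem State.fairRWork_delay_le (hg : IsServiceFunction Δ g) {j : Fin N}
    (hj : j ∈ s.active a) : fairRWork M g δ (s.active a) j (s.delay M g δ a) ≤ s.work j := by
  by_contra! h
  have hw := (State.mem_active.1 hj).2
  obtain ⟨d, hd, hdw⟩ := intermediate_value_Ioo State.delay_nonneg
    (continuous_fairRWork hg).continuousOn ⟨by rwa [fairRWork_zero hg], h⟩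
  exact hd.2.not_ge (State.delay_le hd.1 (Or.inr ⟨j, hj, hdw.ge⟩))

/-- The first event after a snapshot with an incomplete job exists. -/
theorem State.delay_spec (hg : IsServiceFunction Δ g) (hδ : 0 < δ) (hM : 0 < M)
    (h : ∃ j, 0 < s.work j) :
    0 < s.delay M g δ a ∧ ((∃ j, s.time + s.delay M g δ a = a j) ∨
      ∃ j ∈ s.active a, s.work j ≤ fairRWork M g δ (s.active a) j (s.delay M g δ a)) := by
  set E := {d : ℝ | 0 < d ∧ ((∃ j, s.time + d = a j) ∨
    ∃ j ∈ s.active a, s.work j ≤ fairRWork M g δ (s.active a) j d)} with hE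
  have hne : E.Nonempty := by
    obtain ⟨j, hj⟩ := h
    by_cases hja : s.time < a j
    · exact ⟨a j - s.time, sub_pos.2 hja, Or.inl ⟨j, by ring⟩⟩
    · have hA : (s.active a).Nonempty := ⟨j, State.mem_active.2 ⟨not_lt.1 hja, hj⟩⟩
      -- The job i is not known in advance, so the target is a bound on the unprocessed work of
      -- every job.
      obtain ⟨i, hi, d, hd, hw⟩ := exists_le_fairRWork hg hδ hM hA (∑ j, |s.work j|)
      refine ⟨d, hd, Or.inr ⟨i, hi, le_trans ?_ hw⟩⟩
      exact (le_abs_self _).trans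
        (Finset.single_le_sum (f := fun j => |s.work j|) (fun _ _ => abs_nonneg _)
          (Finset.mem_univ i))
  -- The constraint d > 0 can be relaxed to d ≥ 0 because d = 0 satisfies neither event condition
  -- once arrivals are required to be in the future. This exhibits E as closed, so its infimum is
  -- attained.
  have hE' : E = Set.Ici 0 ∩ ((⋃ j, {d | s.time < a j ∧ s.time + d = a j}) ∪
      ⋃ j ∈ s.active a, {d | s.work j ≤ fairRWork M g δ (s.active a) j d}) := by
    ext d
    simp only [hE, Set.mem_ofPred_eq, Set.mem_inter_iff, Set.mem_Ici, Set.mem_union,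
      Set.mem_iUnion, exists_prop]
    constructor
    · rintro ⟨hd, ⟨j, hj⟩ | hj⟩
      · exact ⟨hd.le, Or.inl ⟨j, by linarith, hj⟩⟩
      · exact ⟨hd.le, Or.inr hj⟩
    · rintro ⟨hd, ⟨j, hj, hj'⟩ | ⟨j, hj, hw⟩⟩
      · exact ⟨by linarith, Or.inl ⟨j, hj'⟩⟩
      · refine ⟨hd.lt_of_ne ?_, Or.inr ⟨j, hj, hw⟩⟩
        rintro rfl
        rw [fairRWork_zero hg] at hw
        exact hw.not_gt (State.mem_active.1 hj).2
  have hclosed : IsClosed E := by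
    rw [hE']
    refine isClosed_Ici.inter (IsClosed.union (isClosed_iUnion_of_finite fun j => ?_)
      ((s.active a).finite_toSet.isClosed_biUnion fun j _ =>
        isClosed_le continuous_const (continuous_fairRWork hg)))
    exact isClosed_const.inter (isClosed_eq (continuous_const.add continuous_id) continuous_const)
  exact hclosed.csInf_mem hne ⟨0, fun d hd => hd.1.le⟩

end Delay

/-! ### The run of Fair+R -/

section Run

variable {N M : ℕ} {Δ δ : ℝ} {g : ℕ → ℝ → ℝ} {a p : Fin N → ℝ}

theorem fairRState_time_succ (m : ℕ) : (fairRState M g δ a p (m + 1)).time =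
    (fairRState M g δ a p m).time + (fairRState M g δ a p m).delay M g δ a := rfl

theorem fairRState_work_succ (m : ℕ) (j : Fin N) : (fairRState M g δ a p (m + 1)).work j =
    (fairRState M g δ a p m).work j - fairRWork M g δ ((fairRState M g δ a p m).active a) j
      ((fairRState M g δ a p m).delay M g δ a) := rfl

theorem fairRState_time_le_succ (m : ℕ) :
    (fairRState M g δ a p m).time ≤ (fairRState M g δ a p (m + 1)).time :=
  le_add_of_nonneg_right State.delay_nonneg

theorem fairRState_time_nonneg (m : ℕ) : 0 ≤ (fairRState M g δ a p m).time := by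
  induction m with
  | zero => exact le_rfl
  | succ m ih => exact ih.trans (fairRState_time_le_succ m)

theorem fairRState_work_succ_le (hg : IsServiceFunction Δ g) (hδ : 0 < δ) (m : ℕ) (j : Fin N) :
    (fairRState M g δ a p (m + 1)).work j ≤ (fairRState M g δ a p m).work j :=
  sub_le_self _ (fairRWork_nonneg hg hδ State.delay_nonneg)

theorem fairRState_work_nonneg (hg : IsServiceFunction Δ g) (hp : ∀ j, 0 < p j) (m : ℕ)
    (j : Fin N) : 0 ≤ (fairRState M g δ a p m).work j := by
  induction m with
  | zero => exact (hp j).le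
  | succ m ih =>
    rw [fairRState_work_succ]
    by_cases hj : j ∈ (fairRState M g δ a p m).active a
    · exact sub_nonneg.2 (State.fairRWork_delay_le hg hj)
    · rwa [fairRWork_of_notMem _ hj, sub_zero]

theorem fairRState_work_of_time_le (hg : IsServiceFunction Δ g) (m : ℕ) (j : Fin N)
    (h : (fairRState M g δ a p m).time ≤ a j) : (fairRState M g δ a p m).work j = p j := by
  induction m with
  | zero => rfl
  | succ m ih =>
    have hle := (fairRState_time_le_succ m).trans h
    rw [fairRState_work_succ, ih hle]
    rcases hle.lt_or_eq with hlt | heq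
    · rw [fairRWork_of_notMem _ fun hj => hlt.not_ge (State.mem_active.1 hj).1, sub_zero]
    · have hd : (fairRState M g δ a p m).delay M g δ a = 0 := by
        refine le_antisymm ?_ State.delay_nonneg
        rw [fairRState_time_succ] at h
        linarith
      rw [hd, fairRWork_zero hg, sub_zero]

theorem fairRState_time_succ_le_of_mem_active (hg : IsServiceFunction Δ g) (hδ : 0 < δ) (m : ℕ)
    {j : Fin N} (hj : j ∈ (fairRState M g δ a p (m + 1)).active a)
    (hj' : j ∉ (fairRState M g δ a p m).active a) :
    (fairRState M g δ a p (m + 1)).time ≤ a j := by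
  refine State.time_add_delay_le ?_
  by_contra! h
  exact hj' (State.mem_active.2 ⟨h,
    (State.mem_active.1 hj).2.trans_le (fairRState_work_succ_le hg hδ m j)⟩)

/-- Jobs numbered before an active job have already arrived, so only departures can alter its
position. -/
theorem position_active_succ_le (hg : IsServiceFunction Δ g) (hδ : 0 < δ) (ha : Monotone a) (m : ℕ)
    {j : Fin N} (hj : j ∈ (fairRState M g δ a p m).active a) :
    position ((fairRState M g δ a p (m + 1)).active a) j ≤
      position ((fairRState M g δ a p m).active a) j := by
  refine Finset.card_le_card fun i hi => ?_
  rw [Finset.mem_filter, State.mem_active] at hi ⊢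
  exact ⟨⟨(ha hi.2).trans (State.mem_active.1 hj).1,
    hi.1.2.trans_le (fairRState_work_succ_le hg hδ m i)⟩, hi.2⟩

/-- The number of jobs that have not arrived plus the number of jobs that are not complete. -/
noncomputable def State.remainingEvents (a : Fin N → ℝ) (s : State N) : ℕ :=
  open Classical in
  (Finset.univ.filter fun j => s.time < a j).card + (Finset.univ.filter fun j => 0 < s.work j).card

/-- Each event is an arrival or a departure, and neither can be undone. This makes the run finite.
-/
theorem remainingEvents_succ_lt (hg : IsServiceFunction Δ g) (hδ : 0 < δ) (hM : 0 < M) (m : ℕ)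
    (h : ∃ j, 0 < (fairRState M g δ a p m).work j) :
    (fairRState M g δ a p (m + 1)).remainingEvents a <
      (fairRState M g δ a p m).remainingEvents a := by
  classical
  have h1 : (Finset.univ.filter fun j => (fairRState M g δ a p (m + 1)).time < a j) ⊆
      Finset.univ.filter fun j => (fairRState M g δ a p m).time < a j := fun j hj => by
    rw [Finset.mem_filter] at hj ⊢
    exact ⟨hj.1, (fairRState_time_le_succ m).trans_lt hj.2⟩
  have h2 : (Finset.univ.filter fun j => 0 < (fairRState M g δ a p (m + 1)).work j) ⊆
      Finset.univ.filter fun j => 0 < (fairRState M g δ a p m).work j := fun j hj => by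
    rw [Finset.mem_filter] at hj ⊢
    exact ⟨hj.1, hj.2.trans_le (fairRState_work_succ_le hg hδ m j)⟩
  unfold State.remainingEvents
  obtain ⟨hd, ⟨j, hj⟩ | ⟨j, hj, hw⟩⟩ := State.delay_spec (a := a) hg hδ hM h
  · refine add_lt_add_of_lt_of_le (Finset.card_lt_card ?_) (Finset.card_le_card h2)
    refine (Finset.ssubset_iff_of_subset h1).2 ⟨j, ?_, ?_⟩
    · simp [← hj, hd]
    · simp [fairRState_time_succ, hj]
  · refine add_lt_add_of_le_of_lt (Finset.card_le_card h1) (Finset.card_lt_card ?_)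
    refine (Finset.ssubset_iff_of_subset h2).2 ⟨j, ?_, ?_⟩
    · simp [(State.mem_active.1 hj).2]
    · simp [fairRState_work_succ, hw]

theorem exists_fairRState_work_nonpos (hg : IsServiceFunction Δ g) (hδ : 0 < δ) (hM : 0 < M)
    (a p : Fin N → ℝ) : ∃ m, ∀ j, (fairRState M g δ a p m).work j ≤ 0 := by
  by_contra! h
  have key : ∀ m, (fairRState M g δ a p m).remainingEvents a + m ≤
      (fairRState M g δ a p 0).remainingEvents a := by
    intro m
    induction m with
    | zero => exact le_rfl
    | succ m ih =>
      have := remainingEvents_succ_lt hg hδ hM m (h m)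
      omega
  have := key ((fairRState M g δ a p 0).remainingEvents a + 1)
  omega

/-- The time for which job `j` has been active under Fair+R before the `m`-th event. -/
noncomputable def activeTime (M : ℕ) (g : ℕ → ℝ → ℝ) (δ : ℝ) (a p : Fin N → ℝ) (m : ℕ)
    (j : Fin N) : ℝ :=
  ∑ i ∈ Finset.range m, if j ∈ (fairRState M g δ a p i).active a then
    (fairRState M g δ a p i).delay M g δ a else 0

theorem activeTime_succ (m : ℕ) (j : Fin N) : activeTime M g δ a p (m + 1) j =
    activeTime M g δ a p m j + if j ∈ (fairRState M g δ a p m).active a then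
      (fairRState M g δ a p m).delay M g δ a else 0 :=
  Finset.sum_range_succ _ _

theorem activeTime_of_time_le (m : ℕ) (j : Fin N)
    (h : (fairRState M g δ a p m).time ≤ a j) : activeTime M g δ a p m j = 0 := by
  induction m with
  | zero => rfl
  | succ m ih =>
    have hle := (fairRState_time_le_succ m).trans h
    rw [activeTime_succ, ih hle, zero_add]
    split_ifs with hj
    · refine le_antisymm ?_ State.delay_nonneg
      have := (State.mem_active.1 hj).1
      rw [fairRState_time_succ] at h
      linarith
    · rfl

theorem activeTime_of_work_pos (hg : IsServiceFunction Δ g) (hδ : 0 < δ) (ha : ∀ j, 0 ≤ a j)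
    (m : ℕ) (j : Fin N) (h : a j ≤ (fairRState M g δ a p m).time)
    (hw : 0 < (fairRState M g δ a p m).work j) :
    activeTime M g δ a p m j = (fairRState M g δ a p m).time - a j := by
  induction m with
  | zero => exact (sub_eq_zero.2 (le_antisymm (ha j) h)).symm
  | succ m ih =>
    have hw' := hw.trans_le (fairRState_work_succ_le hg hδ m j)
    by_cases hj : a j ≤ (fairRState M g δ a p m).time
    · rw [activeTime_succ, ih hj hw', if_pos (State.mem_active.2 ⟨hj, hw'⟩), fairRState_time_succ]
      ring
    · have hle : (fairRState M g δ a p (m + 1)).time ≤ a j :=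
        State.time_add_delay_le (not_le.1 hj)
      rw [activeTime_of_time_le _ _ hle]
      linarith

theorem fairRFlowtime_le_activeTime (hg : IsServiceFunction Δ g) (hδ : 0 < δ) (ha : ∀ j, 0 ≤ a j)
    (hp : ∀ j, 0 < p j) (m : ℕ) (j : Fin N) (hw : (fairRState M g δ a p m).work j ≤ 0) :
    fairRFlowtime M g δ a p j ≤ ENNReal.ofReal (activeTime M g δ a p m j) := by
  induction m with
  | zero => exact absurd hw (not_le.2 (hp j))
  | succ m ih =>
    rcases le_or_gt ((fairRState M g δ a p m).work j) 0 with h | h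
    · refine (ih h).trans (ENNReal.ofReal_le_ofReal ?_)
      rw [activeTime_succ]
      refine le_add_of_nonneg_right ?_
      split_ifs
      exacts [State.delay_nonneg, le_rfl]
    · have hj : j ∈ (fairRState M g δ a p m).active a := by
        by_contra hj
        rw [fairRState_work_succ, fairRWork_of_notMem _ hj, sub_zero] at hw
        exact hw.not_gt h
      have hT : activeTime M g δ a p (m + 1) j =
          (fairRState M g δ a p (m + 1)).time - a j := by
        rw [activeTime_succ, activeTime_of_work_pos hg hδ ha m j (State.mem_active.1 hj).1 h,
          if_pos hj, fairRState_time_succ]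
        ring
      rw [hT]
      exact iInf₂_le (m + 1) hw

/-- Total flowtime is the integral over time of the number of active jobs. -/
theorem sum_activeTime_succ (m : ℕ) : ∑ j, activeTime M g δ a p (m + 1) j =
    ∑ j, activeTime M g δ a p m j + ((fairRState M g δ a p m).active a).card *
      (fairRState M g δ a p m).delay M g δ a := by
  simp only [activeTime_succ, Finset.sum_add_distrib, Finset.sum_ite_mem, Finset.univ_inter,
    Finset.sum_const, nsmul_eq_mul]

end Run

/-! ### The potential function -/

/-- The weight of the active job at position `i` in the potential function. -/
noncomputable def rankWeight (M i : ℕ) : ℝ := max 1 (i / M : ℝ)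

theorem rankWeight_nonneg (M i : ℕ) : 0 ≤ rankWeight M i :=
  zero_le_one.trans (le_max_left _ _)

theorem rankWeight_mono (M : ℕ) : Monotone (rankWeight M) := fun _ _ hij =>
  max_le_max le_rfl (div_le_div_of_nonneg_right (Nat.cast_le.2 hij) (Nat.cast_nonneg _))

theorem rankWeight_of_le {M i : ℕ} (hM : 0 < M) (h : i ≤ M) : rankWeight M i = 1 :=
  max_eq_left ((div_le_one (Nat.cast_pos.2 hM)).2 (Nat.cast_le.2 h))

theorem rankWeight_of_ge {M i : ℕ} (hM : 0 < M) (h : M ≤ i) : rankWeight M i = i / M :=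
  max_eq_right ((one_le_div (Nat.cast_pos.2 hM)).2 (Nat.cast_le.2 h))

/-! ### Change of the weighted lags within one period. -/

section Period

variable {N M : ℕ} {Δ δ d : ℝ} {A : Finset (Fin N)} {D U T : Fin N → ℝ}

/-- The change of the potential in a period with fewer active jobs than machines. -/
theorem sum_rankWeight_mul_le_of_card_lt (hM : 0 < M) (hA : A.card < M)
    (hUT : ∀ j ∈ A, U j ≤ Δ * T j) (hD : ∀ j ∈ A, D j ≤ U j - δ * (d - T j)) :
    ∑ j ∈ A, rankWeight M (position A j) * D j ≤ (Δ + δ) * ∑ j ∈ A, T j - δ * (A.card * d) := by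
  calc ∑ j ∈ A, rankWeight M (position A j) * D j
      ≤ ∑ j ∈ A, ((Δ + δ) * T j - δ * d) := by
        refine Finset.sum_le_sum fun j hj => ?_
        rw [rankWeight_of_le hM ((position_le_card A j).trans hA.le), one_mul]
        linarith [hUT j hj, hD j hj]
    _ = _ := by
        rw [Finset.sum_sub_distrib, ← Finset.mul_sum, Finset.sum_const, nsmul_eq_mul]
        ring

/-- The change of the potential in a period with at least as many active jobs as machines. -/
theorem sum_rankWeight_mul_le_of_le_card (hM : 0 < M) (hδ : 0 < δ) (hd : 0 ≤ d)
    (hA : M ≤ A.card) (hU : ∀ j ∈ A, 0 ≤ U j) (hUM : ∑ j ∈ A, U j ≤ M * d)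
    (hT : ∀ j ∈ A, 0 ≤ T j) (hD : ∀ j ∈ A, D j ≤ U j -
      (if A.card % M < position A j then δ / (A.card / M : ℕ) else 0) * (d - T j)) :
    ∑ j ∈ A, rankWeight M (position A j) * D j ≤
      A.card * d - δ / 2 * (A.card * d) + 2 * δ * ∑ j ∈ A, T j := by
  set n := A.card with hn
  set k := n / M with hk
  have hk0 : 0 < k := Nat.div_pos hA hM
  have hkR : (0 : ℝ) < k := Nat.cast_pos.2 hk0
  have hMR : (0 : ℝ) < M := Nat.cast_pos.2 hM
  set v : Fin N → ℝ := fun j => if n % M < position A j then δ / k else 0 with hv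
  have hv0 : ∀ j, 0 ≤ v j := fun j => by
    simp only [hv]
    split_ifs <;> positivity
  have hvk : ∀ j, v j ≤ δ / k := fun j => by
    simp only [hv]
    split_ifs
    exacts [le_rfl, by positivity]
  have hw : ∀ j, rankWeight M (position A j) ≤ n / M := fun j =>
    (rankWeight_mono M (position_le_card A j)).trans_eq (rankWeight_of_ge hM hA)
  -- n/M < k + 1 ≤ 2k, as k ≥ 1.
  have hn2 : (n : ℝ) / M ≤ 2 * k := by
    rw [div_le_iff₀ hMR]
    have h1 : n < (k + 1) * M := by
      rw [← Nat.div_lt_iff_lt_mul hM]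
      exact Nat.lt_succ_self _
    have h2 : (k + 1) * M ≤ 2 * k * M := Nat.mul_le_mul_right _ (by omega)
    exact_mod_cast h1.le.trans h2
  have hU' : ∑ j ∈ A, rankWeight M (position A j) * U j ≤ n * d := by
    calc ∑ j ∈ A, rankWeight M (position A j) * U j ≤ ∑ j ∈ A, (n : ℝ) / M * U j :=
          Finset.sum_le_sum fun j hj => mul_le_mul_of_nonneg_right (hw j) (hU j hj)
      _ = (n : ℝ) / M * ∑ j ∈ A, U j := by rw [Finset.mul_sum]
      _ ≤ (n : ℝ) / M * (M * d) := mul_le_mul_of_nonneg_left hUM (by positivity)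
      _ = n * d := by field_simp
  have hT' : ∑ j ∈ A, rankWeight M (position A j) * v j * T j ≤ 2 * δ * ∑ j ∈ A, T j := by
    rw [Finset.mul_sum]
    refine Finset.sum_le_sum fun j hj => mul_le_mul_of_nonneg_right ?_ (hT j hj)
    calc rankWeight M (position A j) * v j ≤ 2 * k * (δ / k) :=
          mul_le_mul ((hw j).trans hn2) (hvk j) (hv0 j) (by positivity)
      _ = 2 * δ := by field_simp
  -- Here w(i) ≥ i/M is used, together with the lower bound kMn/2 on the sum of the served
  -- positions.
  have hpos : δ / 2 * n ≤ ∑ j ∈ A, rankWeight M (position A j) * v j := by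
    calc δ / 2 * n = δ / (2 * k * M) * (k * M * n : ℕ) := by
          push_cast
          field_simp
      _ ≤ δ / (2 * k * M) *
          ((2 * ∑ j ∈ A, (if n % M < position A j then position A j else 0) : ℕ) : ℝ) :=
          mul_le_mul_of_nonneg_left
            (Nat.cast_le.2 (card_mul_le_two_mul_sum_position A M)) (by positivity)
      _ = ∑ j ∈ A, (position A j / M : ℝ) * v j := by
          push_cast
          rw [Finset.mul_sum, Finset.mul_sum]
          refine Finset.sum_congr rfl fun j _ => ?_
          simp only [hv]
          split_ifs
          · field_simp
          · simp
      _ ≤ _ := Finset.sum_le_sum fun j _ =>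
          mul_le_mul_of_nonneg_right (le_max_right _ _) (hv0 j)
  calc ∑ j ∈ A, rankWeight M (position A j) * D j
      ≤ ∑ j ∈ A, (rankWeight M (position A j) * U j - rankWeight M (position A j) * v j * d +
          rankWeight M (position A j) * v j * T j) := by
        refine Finset.sum_le_sum fun j hj => ?_
        have := mul_le_mul_of_nonneg_left (hD j hj) (rankWeight_nonneg M (position A j))
        linarith
    _ = ∑ j ∈ A, rankWeight M (position A j) * U j -
          (∑ j ∈ A, rankWeight M (position A j) * v j) * d +
          ∑ j ∈ A, rankWeight M (position A j) * v j * T j := by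
        rw [Finset.sum_add_distrib, Finset.sum_sub_distrib, Finset.sum_mul]
    _ ≤ _ := by linarith [mul_le_mul_of_nonneg_right hpos hd]

end Period

/-! ### The amortized comparison with a feasible schedule. -/

section Potential

variable {N M : ℕ} {Δ δ ε : ℝ} {g : ℕ → ℝ → ℝ} {a p : Fin N → ℝ} {z : Schedule N}

/-- The amount by which Fair+R is behind the schedule `z` on job `j` at the `m`-th event. -/
noncomputable def lag (M : ℕ) (g : ℕ → ℝ → ℝ) (δ : ℝ) (a p : Fin N → ℝ) (z : Schedule N) (m : ℕ)
    (j : Fin N) : ℝ :=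
  max ((fairRState M g δ a p m).work j -
    (p j - z.workDone g j (fairRState M g δ a p m).time)) 0

/-- The sum of the lags of the active jobs, weighted according to their positions. -/
noncomputable def potential (M : ℕ) (g : ℕ → ℝ → ℝ) (δ : ℝ) (a p : Fin N → ℝ) (z : Schedule N)
    (m : ℕ) : ℝ :=
  ∑ j ∈ (fairRState M g δ a p m).active a,
    rankWeight M (position ((fairRState M g δ a p m).active a) j) * lag M g δ a p z m j

theorem lag_nonneg (m : ℕ) (j : Fin N) : 0 ≤ lag M g δ a p z m j := le_max_right _ _

theorem potential_nonneg (m : ℕ) : 0 ≤ potential M g δ a p z m :=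
  Finset.sum_nonneg fun _ _ => mul_nonneg (rankWeight_nonneg _ _) (lag_nonneg _ _)

theorem lag_of_time_le (hz : z.IsFeasible M g a p) (hg : IsServiceFunction Δ g) (m : ℕ) (j : Fin N)
    (h : (fairRState M g δ a p m).time ≤ a j) : lag M g δ a p z m j = 0 := by
  rw [lag, fairRState_work_of_time_le hg m j h, hz.workDone_of_le j h]
  simp

theorem potential_zero (hz : z.IsFeasible M g a p) (hg : IsServiceFunction Δ g)
    (ha : ∀ j, 0 ≤ a j) : potential M g δ a p z 0 = 0 :=
  Finset.sum_eq_zero fun j _ => by rw [lag_of_time_le hz hg 0 j (ha j), mul_zero]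

/-- Here v is a lower bound on the average rate of Fair+R. The decrease is credited only for the
time at which `z` is not working on the job. This is what makes the truncation of the lag at 0
harmless. -/
theorem lag_succ_sub_le (hz : z.IsFeasible M g a p) (hg : IsServiceFunction Δ g) (hδ : 0 < δ)
    (hp : ∀ j, 0 < p j) (m : ℕ) {j : Fin N} (hj : j ∈ (fairRState M g δ a p m).active a) {v : ℝ}
    (hv : 0 ≤ v) (hvd : v * (fairRState M g δ a p m).delay M g δ a ≤
      fairRWork M g δ ((fairRState M g δ a p m).active a) j
        ((fairRState M g δ a p m).delay M g δ a)) :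
    lag M g δ a p z (m + 1) j - lag M g δ a p z m j ≤
      (z.workDone g j (fairRState M g δ a p (m + 1)).time -
        z.workDone g j (fairRState M g δ a p m).time) -
      v * ((fairRState M g δ a p m).delay M g δ a -
        (elapsed (a j) (z.completion j) (fairRState M g δ a p (m + 1)).time -
          elapsed (a j) (z.completion j) (fairRState M g δ a p m).time)) := by
  have ht := fairRState_time_succ (M := M) (g := g) (δ := δ) (a := a) (p := p) m
  have htm := fairRState_time_le_succ (M := M) (g := g) (δ := δ) (a := a) (p := p) m
  have hw := fairRState_work_succ (M := M) (g := g) (δ := δ) (a := a) (p := p) m j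
  have hnext := fairRState_work_nonneg (M := M) (δ := δ) (a := a) hg hp (m + 1) j
  have hle := fairRState_work_succ_le (M := M) (a := a) (p := p) hg hδ m j
  have hU := hz.workDone_mono hg j htm
  -- If `z` has completed the job by the end of the period, the new lag is all of the remaining
  -- work, so the truncation is inactive there. Otherwise the job is alive in `z` throughout, no
  -- decrease is claimed, and the lag grows by at most the work of `z`.
  rcases le_or_gt (z.completion j) (fairRState M g δ a p (m + 1)).time with h | h
  · have h1 : lag M g δ a p z (m + 1) j = (fairRState M g δ a p (m + 1)).work j := by
      rw [lag, hz.workDone_of_ge j h, sub_self, sub_zero, max_eq_left hnext]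
    have h2 : (fairRState M g δ a p m).work j -
        (p j - z.workDone g j (fairRState M g δ a p m).time) ≤ lag M g δ a p z m j :=
      le_max_left _ _
    have h3 := mul_nonneg hv (sub_nonneg.2 (elapsed_mono (hz.arrival_le_completion j) htm))
    rw [h1, hz.workDone_of_ge j h]
    linarith
  · rw [elapsed_sub_of_mem (State.mem_active.1 hj).1 htm h.le, ht, add_sub_cancel_left, sub_self,
      mul_zero, sub_zero, ← ht]
    rw [sub_le_iff_le_add']
    have h0 := lag_nonneg (M := M) (g := g) (δ := δ) (a := a) (p := p) (z := z) m j
    refine max_le ?_ (by linarith)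
    have h2 : (fairRState M g δ a p m).work j -
        (p j - z.workDone g j (fairRState M g δ a p m).time) ≤ lag M g δ a p z m j :=
      le_max_left _ _
    linarith

/-- Arrivals and departures do not increase the potential. -/
theorem potential_succ_le (hz : z.IsFeasible M g a p) (hg : IsServiceFunction Δ g) (hδ : 0 < δ)
    (ha : Monotone a) (m : ℕ) : potential M g δ a p z (m + 1) ≤
      ∑ j ∈ (fairRState M g δ a p m).active a,
        rankWeight M (position ((fairRState M g δ a p m).active a) j) *
          lag M g δ a p z (m + 1) j := by
  unfold potential
  rw [← Finset.sum_subset (Finset.inter_subset_left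
    (s₂ := (fairRState M g δ a p m).active a))]
  · refine (Finset.sum_le_sum fun j hj => ?_).trans (Finset.sum_le_sum_of_subset_of_nonneg
      Finset.inter_subset_right fun j _ _ => mul_nonneg (rankWeight_nonneg _ _) (lag_nonneg _ _))
    exact mul_le_mul_of_nonneg_right (rankWeight_mono M
      (position_active_succ_le hg hδ ha m (Finset.mem_inter.1 hj).2)) (lag_nonneg _ _)
  -- A newly active job arrives exactly at this event, so its lag is still 0.
  · intro j hj hj'
    rw [lag_of_time_le hz hg (m + 1) j (fairRState_time_succ_le_of_mem_active hg hδ m hj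
      fun h => hj' (Finset.mem_inter.2 ⟨hj, h⟩)), mul_zero]

/-- The factor c = 1/(1+ε/2) solves c(δ/2 − 1) = 1 for δ = 4+ε, so that with n ≥ M the potential
pays exactly for the n active jobs. -/
theorem card_mul_delay_add_potential_le (hz : z.IsFeasible M g a p) (hg : IsServiceFunction Δ g)
    (hM : 0 < M) (hε : 0 < ε) (ha : Monotone a) (hp : ∀ j, 0 < p j) (m : ℕ) :
    ((fairRState M g (4 + ε) a p m).active a).card *
        (fairRState M g (4 + ε) a p m).delay M g (4 + ε) a +
      1 / (1 + ε / 2) * (potential M g (4 + ε) a p z (m + 1) - potential M g (4 + ε) a p z m) ≤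
    (Δ + 8) * ∑ j, (elapsed (a j) (z.completion j) (fairRState M g (4 + ε) a p (m + 1)).time -
      elapsed (a j) (z.completion j) (fairRState M g (4 + ε) a p m).time) := by
  have hδ : 0 < 4 + ε := by linarith
  have hΔ := hg.one_le_peak
  have hpot := potential_succ_le (p := p) hz hg hδ ha m
  have htm := fairRState_time_le_succ (M := M) (g := g) (δ := 4 + ε) (a := a) (p := p) m
  have ht := fairRState_time_succ (M := M) (g := g) (δ := 4 + ε) (a := a) (p := p) m
  have ht0 := fairRState_time_nonneg (M := M) (g := g) (δ := 4 + ε) (a := a) (p := p) m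
  have hd0 : 0 ≤ (fairRState M g (4 + ε) a p m).delay M g (4 + ε) a := State.delay_nonneg
  set T : Fin N → ℝ := fun j =>
    elapsed (a j) (z.completion j) (fairRState M g (4 + ε) a p (m + 1)).time -
      elapsed (a j) (z.completion j) (fairRState M g (4 + ε) a p m).time with hT
  set U : Fin N → ℝ := fun j => z.workDone g j (fairRState M g (4 + ε) a p (m + 1)).time -
      z.workDone g j (fairRState M g (4 + ε) a p m).time with hU
  set D : Fin N → ℝ := fun j =>
    lag M g (4 + ε) a p z (m + 1) j - lag M g (4 + ε) a p z m j with hD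
  have hT0 : ∀ j, 0 ≤ T j := fun j =>
    sub_nonneg.2 (elapsed_mono (hz.arrival_le_completion j) htm)
  have hU0 : ∀ j, 0 ≤ U j := fun j => sub_nonneg.2 (hz.workDone_mono hg j htm)
  have hUM := hz.sum_workDone_sub_le hg ht0 htm
  have hUT : ∀ j, U j ≤ Δ * T j := fun j => hz.workDone_sub_le_peak hg j htm
  have hpot' : potential M g (4 + ε) a p z (m + 1) - potential M g (4 + ε) a p z m ≤
      ∑ j ∈ (fairRState M g (4 + ε) a p m).active a,
        rankWeight M (position ((fairRState M g (4 + ε) a p m).active a) j) * D j := by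
    simp only [hD, mul_sub, Finset.sum_sub_distrib]
    exact sub_le_sub_right hpot _
  have hTA : ∑ j ∈ (fairRState M g (4 + ε) a p m).active a, T j ≤ ∑ j, T j :=
    Finset.sum_le_sum_of_subset_of_nonneg (Finset.subset_univ _) fun j _ _ => hT0 j
  have hTA0 : 0 ≤ ∑ j ∈ (fairRState M g (4 + ε) a p m).active a, T j :=
    Finset.sum_nonneg fun j _ => hT0 j
  have hnd : 0 ≤ (((fairRState M g (4 + ε) a p m).active a).card : ℝ) *
      (fairRState M g (4 + ε) a p m).delay M g (4 + ε) a := mul_nonneg (Nat.cast_nonneg _) hd0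
  have hc0 : 0 < 1 / (1 + ε / 2) := by positivity
  have hc1 : 1 / (1 + ε / 2) ≤ 1 := by
    rw [div_le_one (by positivity)]
    linarith
  -- With c ≤ 1, the coefficient of T is at most cΔ + 2 + 2c ≤ Δ + 4 when n < M, and 2cδ = 4 + 4c ≤
  -- 8 when n ≥ M.
  have hcδ : 1 / (1 + ε / 2) * (4 + ε) = 2 + 2 * (1 / (1 + ε / 2)) := by
    field_simp
    ring
  have hK : (Δ + 8) * ∑ j ∈ (fairRState M g (4 + ε) a p m).active a, T j ≤ (Δ + 8) * ∑ j, T j :=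
    mul_le_mul_of_nonneg_left hTA (by linarith)
  refine le_trans ?_ hK
  refine (add_le_add_right (mul_le_mul_of_nonneg_left hpot' hc0.le) _).trans ?_
  generalize 1 / (1 + ε / 2) = c at hc0 hc1 hcδ ⊢
  have hcT := mul_le_mul_of_nonneg_right hc1 hTA0
  rcases lt_or_ge ((fairRState M g (4 + ε) a p m).active a).card M with hA | hA
  · have h := sum_rankWeight_mul_le_of_card_lt (D := D) hM hA (fun j _ => hUT j) fun j hj =>
      lag_succ_sub_le hz hg hδ hp m hj hδ.le (le_fairRWork_of_card_lt hg hδ hd0 hA hj)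
    have hcΔT := mul_le_mul_of_nonneg_left hcT (zero_le_one.trans hΔ)
    have hcn := mul_nonneg hc0.le hnd
    refine (add_le_add_right (mul_le_mul_of_nonneg_left h hc0.le) _).trans ?_
    rw [mul_sub, ← mul_assoc c, ← mul_assoc c, mul_add c, hcδ]
    linarith
  · have h := sum_rankWeight_mul_le_of_le_card (D := D) (U := U) (T := T) hM hδ hd0 hA
      (fun j _ => hU0 j) ((Finset.sum_le_sum_of_subset_of_nonneg (Finset.subset_univ _)
        fun j _ _ => hU0 j).trans (by rwa [ht, add_sub_cancel_left, ← ht] at hUM))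
      (fun j _ => hT0 j) fun j hj => by
        refine lag_succ_sub_le hz hg hδ hp m hj ?_ ?_
        · split_ifs <;> positivity
        · split_ifs with hl
          · exact le_fairRWork_of_le_card hg hδ hd0 hA hj hl
          · rw [zero_mul]
            exact fairRWork_nonneg hg hδ hd0
    refine (add_le_add_right (mul_le_mul_of_nonneg_left h hc0.le) _).trans ?_
    generalize ∑ j ∈ (fairRState M g (4 + ε) a p m).active a, T j = τ at *
    generalize (((fairRState M g (4 + ε) a p m).active a).card : ℝ) *
      (fairRState M g (4 + ε) a p m).delay M g (4 + ε) a = x at *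
    have h1 : c * (x - (4 + ε) / 2 * x + 2 * (4 + ε) * τ) =
        c * x - c * (4 + ε) / 2 * x + 2 * (c * (4 + ε)) * τ := by ring
    rw [h1, hcδ]
    have hΔT := mul_nonneg (zero_le_one.trans hΔ) hTA0
    linarith

theorem sum_activeTime_add_potential_le (hz : z.IsFeasible M g a p) (hg : IsServiceFunction Δ g)
    (hM : 0 < M) (hε : 0 < ε) (ha0 : ∀ j, 0 ≤ a j) (ha : Monotone a) (hp : ∀ j, 0 < p j) (m : ℕ) :
    ∑ j, activeTime M g (4 + ε) a p m j + 1 / (1 + ε / 2) * potential M g (4 + ε) a p z m ≤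
      (Δ + 8) * ∑ j, elapsed (a j) (z.completion j) (fairRState M g (4 + ε) a p m).time := by
  induction m with
  | zero =>
    have h : ∀ j, elapsed (a j) (z.completion j) (fairRState M g (4 + ε) a p 0).time = 0 :=
      fun j => elapsed_of_le (hz.arrival_le_completion j) (ha0 j)
    simp [potential_zero hz hg ha0, activeTime, h]
  | succ m ih =>
    have h := card_mul_delay_add_potential_le hz hg hM hε ha hp m
    rw [Finset.sum_sub_distrib, mul_sub, mul_sub] at h
    rw [sum_activeTime_succ]
    linarith

theorem fairRCost_le (hz : z.IsFeasible M g a p) (hg : IsServiceFunction Δ g) (hM : 0 < M)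
    (hε : 0 < ε) (ha0 : ∀ j, 0 ≤ a j) (ha : Monotone a) (hp : ∀ j, 0 < p j) :
    fairRCost M g (4 + ε) a p ≤
      ENNReal.ofReal (Δ + 8) * ENNReal.ofReal (∑ j, (z.completion j - a j)) := by
  have hδ : 0 < 4 + ε := by linarith
  have hΔ : 0 ≤ Δ + 8 := by linarith [hg.one_le_peak]
  obtain ⟨m, hm⟩ := exists_fairRState_work_nonpos hg hδ hM a p
  have hnonneg : ∀ j, 0 ≤ activeTime M g (4 + ε) a p m j := fun j =>
    Finset.sum_nonneg fun i _ => by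
      split_ifs
      exacts [State.delay_nonneg, le_rfl]
  calc fairRCost M g (4 + ε) a p
      ≤ ∑ j, ENNReal.ofReal (activeTime M g (4 + ε) a p m j) :=
        Finset.sum_le_sum fun j _ => fairRFlowtime_le_activeTime hg hδ ha0 hp m j (hm j)
    _ = ENNReal.ofReal (∑ j, activeTime M g (4 + ε) a p m j) :=
        (ENNReal.ofReal_sum_of_nonneg fun j _ => hnonneg j).symm
    _ ≤ ENNReal.ofReal ((Δ + 8) * ∑ j, (z.completion j - a j)) := by
        refine ENNReal.ofReal_le_ofReal ?_
        have h1 := sum_activeTime_add_potential_le hz hg hM hε ha0 ha hp m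
        have h2 : 0 ≤ 1 / (1 + ε / 2) * potential M g (4 + ε) a p z m :=
          mul_nonneg (by positivity) (potential_nonneg m)
        have h3 := mul_le_mul_of_nonneg_left (Finset.sum_le_sum fun j (_ : j ∈ Finset.univ) =>
          elapsed_le (t := (fairRState M g (4 + ε) a p m).time) (hz.arrival_le_completion j)) hΔ
        linarith
    _ = _ := ENNReal.ofReal_mul hΔ

end Potential

end Redundancy

/-! ### The competitive ratio. -/

theorem theorem2 (Δ : ℝ) :
    ∃ C : ℝ, 0 < C ∧
      ∀ (ε : ℝ), 0 < ε →
      ∀ (M : ℕ), 0 < M →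
      ∀ (Ω : Type*) [MeasurableSpace Ω] (P : Measure Ω) [IsProbabilityMeasure P]
        (S : Fin M → ℝ≥0 → Ω → ℝ), Redundancy.IsServiceCapacity P Δ S →
      ∀ (N : ℕ) (a p : Fin N → ℝ), (∀ j, 0 ≤ a j) → Monotone a → (∀ j, 0 < p j) →
        Redundancy.fairRCost M (Redundancy.meanService P S) (4 + ε) a p ≤
          ENNReal.ofReal (C * (1 + 1 / ε)) *
            Redundancy.optCost M (Redundancy.meanService P S) a p := by
  refine ⟨|Δ| + 8, by positivity, ?_⟩
  intro ε hε M hM Ω _ P _ S hS N a p ha0 ha hp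
  have hC : Δ + 8 ≤ (|Δ| + 8) * (1 + 1 / ε) :=
    calc Δ + 8 ≤ (|Δ| + 8) * 1 := by linarith [le_abs_self Δ]
      _ ≤ (|Δ| + 8) * (1 + 1 / ε) :=
        mul_le_mul_of_nonneg_left (le_add_of_nonneg_right (by positivity)) (by positivity)
  have hpos : ENNReal.ofReal ((|Δ| + 8) * (1 + 1 / ε)) ≠ 0 :=
    (ENNReal.ofReal_pos.2 (by positivity)).ne'
  unfold Redundancy.optCost
  -- The factor is neither 0 nor ∞, so it moves inside the infimum and the bound can be checked
  -- schedule by schedule.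
  rw [ENNReal.mul_iInf_of_ne hpos ENNReal.ofReal_ne_top]
  refine le_iInf fun z => ?_
  rw [ENNReal.mul_iInf_of_ne hpos ENNReal.ofReal_ne_top]
  refine le_iInf fun hz => ?_
  exact (Redundancy.fairRCost_le hz (hS.isServiceFunction hM) hM hε ha0 ha hp).trans
    (mul_le_mul_left (ENNReal.ofReal_le_ofReal hC) _)
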